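/- Let $n\ge 2$ and let $\widetilde C_n$ be the affine Weyl group with Coxeter generators $s_0,\dots,s_n$ and relations $s_i^2=1$, $(s_is_j)^2=1$ for $|i-j|>1$, $(s_is_{i+1})^3=1$ for $1\le i<n-1$, and $(s_is_{i+1})^4=1$ for $i\in\{0,n-1\}$. Let $\ell$ be the length with respect to these generators, and let $\le$ be the left weak order: $u\le w$ iff $w=vu$ for some $v$ with $\ell(w)=\ell(v)+\ell(u)$. Put $a_i:=s_is_{i-1}\cdots s_0$ for $0\le i\le n$. Call an integer vector $\epsilon=(\epsilon_0,\dots,\epsilon_n)$ admissible if $\epsilon_i\in\{0,1\}$ for $0\le i<n$ and $0\le\epsilon_n<n+4$. For admissible $\epsilon$ write $a^\epsilon:=a_0^{\epsilon_0}a_1^{\epsilon_1}\cdots a_n^{\epsilon_n}$, and let $R_n:=\{a^\epsilon:\ \epsilon\text{ admissible}\}$. For $0\le k\le n+1$ let $t_k(\epsilon):=\sum_{i=k}^n\epsilon_i$, so that $t_{n+1}(\epsilon)=0$. Then the following hold. 1. (Dominance.) For all admissible $\epsilon,\delta$: $a^\epsilon\le a^\delta$ if and only if $t_k(\epsilon)\le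 t_k(\delta)$ for all $0\le k\le n$; and $a^\epsilon<a^\delta$ if and only if $t_k(\epsilon)\le t_k(\delta)$ for all $0\le k\le n$ and $\epsilon\ne\delta$. 2. (Meets and joins.) For all admissible $\epsilon,\delta$ let $$\alpha_k:=\min\{t_k(\epsilon),t_k(\delta)\}-\min\{t_{k+1}(\epsilon),t_{k+1}(\delta)\},\qquad \beta_k:=\max\{t_k(\epsilon),t_k(\delta)\}-\max\{t_{k+1}(\epsilon),t_{k+1}(\delta)\}\qquad(0\le k\le n).$$ Then $\alpha$ and $\beta$ are admissible, $t_k(\alpha)=\min\{t_k(\epsilon),t_k(\delta)\}$ and $t_k(\beta)=\max\{t_k(\epsilon),t_k(\delta)\}$ for $0\le k\le n$. Moreover, in the weak order on all of $\widetilde C_n$, the greatest lower bound of $a^\epsilon$ and $a^\delta$ exists and equals $a^\alpha$, and their least upper bound exists and equals $a^\beta$. 3. (Modularity.) $R_n$, ordered by the left weak order, is a modular lattice, whose join $r\vee s$ and meet $r\wedge s$ are also the least upper bound and the greatest lower bound of $r,s$ in the weak order on $\widetilde C_n$; and for all $r,s\in R_n$ $$\ell(r\vee s)+\ell(r\wedge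 s)=\ell(r)+\ell(s).$$ -/

import Mathlib

namespace CTilde

/-- The Coxeter matrix on the index set `{0, …, n}` (`n ≥ 2`) of the affine Weyl group of
type `C̃ₙ`: a path whose two end edges `{0, 1}` and `{n - 1, n}` carry the label `4` and whose
other edges carry the label `3`. -/
def coxeterMatrix (n : ℕ) : CoxeterMatrix (Fin (n + 1)) where
  M := Matrix.of fun i j =>
    if i = j then 1
    else if (i : ℕ) + 1 = j ∨ (j : ℕ) + 1 = i then
      (if (i : ℕ) = 0 ∨ (j : ℕ) = 0 ∨ (i : ℕ) = n ∨ (j : ℕ) = n then 4 else 3)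
    else 2
  isSymm := by
    ext i j
    simp only [Matrix.transpose_apply, Matrix.of_apply]
    split_ifs <;> first | rfl | (exfalso; omega)
  diagonal := by simp
  off_diagonal := by
    intro i j h
    simp only [Matrix.of_apply]
    split_ifs <;> simp_all

/-- The affine Weyl group `C̃ₙ`, presented by its Coxeter generators and relations. -/
abbrev W (n : ℕ) : Type := (coxeterMatrix n).Group

/-- The Coxeter system of `C̃ₙ` with generators `s₀, …, sₙ`. -/
abbrev cs (n : ℕ) : CoxeterSystem (coxeterMatrix n) (W n) := (coxeterMatrix n).toCoxeterSystem

/-- The Coxeter generator `sᵢ`. -/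
def s {n : ℕ} (i : Fin (n + 1)) : W n := (cs n).simple i

/-- The Coxeter length on `C̃ₙ`. -/
noncomputable def len {n : ℕ} (w : W n) : ℕ := (cs n).length w

/-- The left weak order on `C̃ₙ`: `u ≤ w` iff `w = v * u` for some `v` with
`ℓ(w) = ℓ(v) + ℓ(u)`. -/
instance weakOrder (n : ℕ) : PartialOrder (W n) where
  le u w := ∃ v, w = v * u ∧ len w = len v + len u
  le_refl u := ⟨1, by simp [len]⟩
  le_trans := by
    rintro u w x ⟨v, rfl, h⟩ ⟨v', rfl, h'⟩
    refine ⟨v' * v, by group, ?_⟩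
    have h1 : len (v' * v) ≤ len v' + len v := (cs n).length_mul_le v' v
    have h2 : len (v' * v * u) ≤ len (v' * v) + len u := (cs n).length_mul_le (v' * v) u
    rw [mul_assoc] at h2
    omega
  le_antisymm := by
    rintro u w ⟨v, rfl, h⟩ ⟨v', -, h'⟩
    have hv : (cs n).length v = 0 := by
      change len v = 0
      omega
    rw [(cs n).length_eq_zero_iff.mp hv, one_mul]

/-- The element `aᵢ = sᵢ sᵢ₋₁ ⋯ s₀`. -/
def a {n : ℕ} (i : Fin (n + 1)) : W n :=
  Fin.induction (motive := fun _ => W n) (s 0) (fun j x => s j.succ * x) i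

/-- The product `a₀ ^ ε₀ * a₁ ^ ε₁ * ⋯ * aₙ ^ εₙ`, in this order. -/
def word {n : ℕ} (ε : Fin (n + 1) → ℕ) : W n :=
  (List.ofFn fun i => a i ^ ε i).prod

/-- Exponent vectors with `εᵢ ∈ {0, 1}` for `i < n` and `0 ≤ εₙ < n + 4`. -/
def Admissible {n : ℕ} (ε : Fin (n + 1) → ℕ) : Prop :=
  (∀ i : Fin (n + 1), (i : ℕ) < n → ε i ≤ 1) ∧ ε (Fin.last n) < n + 4

/-- The set `Rₙ` of all products `a₀ ^ ε₀ ⋯ aₙ ^ εₙ` with admissible exponents. -/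
def R (n : ℕ) : Set (W n) := {w | ∃ ε : Fin (n + 1) → ℕ, Admissible ε ∧ w = word ε}

/-- The tail sum `∑_{i = k}^{n} εᵢ`, for every natural number `k` (it is `0` for `k = n + 1`). -/
def tail {n : ℕ} (ε : Fin (n + 1) → ℕ) (k : ℕ) : ℕ :=
  ∑ i ∈ Finset.univ.filter (fun i : Fin (n + 1) => k ≤ (i : ℕ)), ε i

/-- The exponents `αₖ`, successive differences of the minima of the tail sums. Tail sums
decrease with `k`, so the subtraction does not truncate. -/
def meetExp {n : ℕ} (ε δ : Fin (n + 1) → ℕ) (k : Fin (n + 1)) : ℕ :=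
  min (tail ε k) (tail δ k) - min (tail ε (k + 1)) (tail δ (k + 1))

/-- The exponents `βₖ`, successive differences of the maxima of the tail sums. Tail sums
decrease with `k`, so the subtraction does not truncate. -/
def joinExp {n : ℕ} (ε δ : Fin (n + 1) → ℕ) (k : Fin (n + 1)) : ℕ :=
  max (tail ε k) (tail δ k) - max (tail ε (k + 1)) (tail δ (k + 1))

end CTilde

/-! The left weak order on a Coxeter group is inclusion of right inversion sets, and the length is
the size of that set. So everything follows from the inversion sets of the words `a^ε`.

Let `c = sₙ ⋯ s₀`. The inversions of `c^e` are the reflections `refl n i j` with `i ≤ n`, `j < e`,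
thought of as boxes at height `j` in column `i`. The inversions of `a^ε` form the diagram whose
column `i` has height `tail ε i`. Multiplying on the left by `aₖ` adds one box to each of the
columns `0, …, k`: up to a factor commuting with `s₀, …, sₖ`, the word already built is a power of
`c`, so it conjugates the relevant reflections as that power does. This is
`exists_coxElt_pow_eq_mul_suffix`.

Distinct boxes must give distinct reflections (`refl_injective`). This is seen in a representation
on sequences with `x (m + n) = x m + N`, where `c` is the shift and `refl n k j` is the reflection
in `x (j + 1) + x (j + 1 + k) = 0`.

Inclusion of diagrams is then comparison of the heights, intersection and union are minimum and
maximum, and both are again diagrams of admissible vectors. Hence they give bounds in the whole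
group. Modularity and the length identity reduce to `min` and `max` of integers. -/

namespace CoxeterSystem

/-! ### Inversion cocycle and the weak order of a Coxeter group -/

variable {B W : Type*} [Group W] {M : CoxeterMatrix B} (cs : CoxeterSystem M W)

open scoped Classical in
/-- The action of a simple reflection on signed elements: conjugation, flipping the sign of the
simple reflection itself. -/
noncomputable def signedConj (i : B) : Equiv.Perm (W × ZMod 2) :=
  Function.Involutive.toPerm
    (fun x => (cs.simple i * x.1 * cs.simple i, x.2 + if x.1 = cs.simple i then 1 else 0)) (by
      rintro ⟨t, z⟩
      have h : cs.simple i * t * cs.simple i = cs.simple i ↔ t = cs.simple i := by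
        constructor
        · intro h
          have := congrArg (fun x => cs.simple i * x * cs.simple i) h
          simpa [mul_assoc] using this
        · rintro rfl
          simp
      simp only [h, Prod.mk.injEq]
      exact ⟨by simp [mul_assoc], by rw [add_assoc, CharTwo.add_self_eq_zero, add_zero]⟩)

open scoped Classical in
theorem signedConj_apply (i : B) (x : W × ZMod 2) : cs.signedConj i x =
    (cs.simple i * x.1 * cs.simple i, x.2 + if x.1 = cs.simple i then 1 else 0) := rfl

-- The sign flips exactly at the reflections `(sᵢsⱼ)⁻ʳ sⱼ` met along the alternating word: even `r`
-- come from the factors `sⱼ`, odd `r` from the factors `sᵢ`.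
open scoped Classical in
theorem signedConj_pow (i j : B) (m : ℕ) (t : W) (z : ZMod 2) :
    ((cs.signedConj i * cs.signedConj j) ^ m) (t, z) =
      ((cs.simple i * cs.simple j) ^ m * t * ((cs.simple i * cs.simple j) ^ m)⁻¹,
        z + ∑ r ∈ Finset.range (2 * m),
          if t = ((cs.simple i * cs.simple j) ^ r)⁻¹ * cs.simple j then 1 else 0) := by
  induction m with
  | zero => simp
  | succ m ih =>
    have hinv : (cs.simple i * cs.simple j)⁻¹ = cs.simple j * cs.simple i := by simp
    -- `sⱼ` conjugates `sᵢsⱼ` to its inverse.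
    have hconj : ∀ r : ℕ, cs.simple j * (cs.simple i * cs.simple j) ^ r =
        ((cs.simple i * cs.simple j) ^ r)⁻¹ * cs.simple j := by
      intro r
      induction r with
      | zero => simp
      | succ r ihr =>
        rw [pow_succ, ← mul_assoc, ihr, mul_inv_rev]
        have : (cs.simple i * cs.simple j)⁻¹ * ((cs.simple i * cs.simple j) ^ r)⁻¹ =
            ((cs.simple i * cs.simple j) ^ r)⁻¹ * (cs.simple i * cs.simple j)⁻¹ := by
          rw [← mul_inv_rev, ← mul_inv_rev, ← pow_succ, ← pow_succ']
        rw [this, hinv]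
        simp only [mul_assoc]
    have h1 : (cs.simple i * cs.simple j) ^ m * t * ((cs.simple i * cs.simple j) ^ m)⁻¹ =
        cs.simple j ↔ t = ((cs.simple i * cs.simple j) ^ (2 * m))⁻¹ * cs.simple j := by
      rw [mul_inv_eq_iff_eq_mul, hconj, two_mul, pow_add, mul_inv_rev, mul_assoc,
        ← eq_inv_mul_iff_mul_eq]
    have h2 : cs.simple j * ((cs.simple i * cs.simple j) ^ m * t *
        ((cs.simple i * cs.simple j) ^ m)⁻¹) * cs.simple j = cs.simple i ↔
        t = ((cs.simple i * cs.simple j) ^ (2 * m + 1))⁻¹ * cs.simple j := by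
      have e : ((cs.simple i * cs.simple j) ^ (2 * m + 1))⁻¹ * cs.simple j =
        ((cs.simple i * cs.simple j) ^ m)⁻¹ * (cs.simple j * cs.simple i * cs.simple j)
          * (cs.simple i * cs.simple j) ^ m := by
        rw [mul_assoc _ _ ((cs.simple i * cs.simple j) ^ m), mul_assoc _ _ ((cs.simple i * cs.simple j) ^ m), hconj,
          ← hinv, ← mul_assoc, ← mul_assoc, ← mul_inv_rev, ← mul_inv_rev, ← pow_succ', ← pow_add]
        congr 3
        omega
      rw [e]
      constructor
      · intro h
        have h' := congrArg (fun x => cs.simple j * x * cs.simple j) h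
        simp only [mul_assoc, cs.simple_mul_simple_self, cs.simple_mul_simple_cancel_left,
          mul_one] at h'
        rw [mul_assoc (cs.simple j), ← h']
        group
      · intro h
        rw [h]
        simp [mul_assoc]
    rw [pow_succ', Equiv.Perm.mul_apply, ih, Equiv.Perm.mul_apply, show 2 * (m + 1) = 2 * m + 1 + 1 by ring,
      Finset.sum_range_succ, Finset.sum_range_succ]
    simp only [signedConj_apply, h1, h2, Prod.mk.injEq]
    refine ⟨?_, by ring⟩
    rw [pow_succ' _ m, mul_inv_rev, hinv]
    group

/-- Since `(sᵢsⱼ)^m = 1` for `m = M i j`, the `2m` reflections run twice through the same list of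
`m`, so the sign changes cancel modulo 2. -/
theorem isLiftable_signedConj : M.IsLiftable cs.signedConj := by
  classical
  intro i j
  ext1 ⟨t, z⟩
  rw [signedConj_pow, two_mul, Finset.sum_range_add]
  simp only [pow_add, cs.simple_mul_simple_pow, one_mul]
  rw [CharTwo.add_self_eq_zero]
  simp

/-- The parity of the number of times `t` occurs in the right inversion sequence of a word
for `w`. -/
noncomputable def invParity (w t : W) : ZMod 2 :=
  ((cs.lift ⟨_, cs.isLiftable_signedConj⟩ w) (t, 0)).2

theorem lift_signedConj_apply (w t : W) (z : ZMod 2) :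
    (cs.lift ⟨_, cs.isLiftable_signedConj⟩ w) (t, z) = (w * t * w⁻¹, z + cs.invParity w t) := by
  classical
  unfold invParity
  induction w using cs.simple_induction_left generalizing z with
  | one => simp
  | mul_simple_left w i ih =>
    rw [map_mul, lift_apply_simple, Equiv.Perm.mul_apply, Equiv.Perm.mul_apply, ih z, ih 0]
    simp [signedConj_apply, mul_assoc, add_assoc]

theorem invParity_mul (u v t : W) :
    cs.invParity (u * v) t = cs.invParity v t + cs.invParity u (v * t * v⁻¹) := by
  have h := cs.lift_signedConj_apply (u * v) t 0
  rw [map_mul, Equiv.Perm.mul_apply, lift_signedConj_apply, lift_signedConj_apply] at h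
  simpa using (congrArg Prod.snd h).symm

@[simp]
theorem invParity_one (t : W) : cs.invParity 1 t = 0 := by
  simp [invParity]

open scoped Classical in
theorem invParity_simple (i : B) (t : W) :
    cs.invParity (cs.simple i) t = if t = cs.simple i then 1 else 0 := by
  simp [invParity, signedConj_apply]

theorem mem_rightInvSeq_of_invParity_ne_zero (ω : List B) (t : W)
    (h : cs.invParity (cs.wordProd ω) t ≠ 0) : t ∈ cs.rightInvSeq ω := by
  induction ω with
  | nil => simp at h
  | cons i ω ih =>
    rw [wordProd_cons, invParity_mul, invParity_simple] at h
    rw [rightInvSeq, List.mem_cons]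
    by_cases hi : cs.wordProd ω * t * (cs.wordProd ω)⁻¹ = cs.simple i
    · left
      rw [← hi]
      group
    · rw [if_neg hi, add_zero] at h
      exact Or.inr (ih h)

/-- In `t = v s v⁻¹` the contributions of `v` and `v⁻¹` cancel, because `v⁻¹ v = 1` has parity zero;
the simple factor contributes 1. -/
theorem IsReflection.invParity_self {t : W} (ht : cs.IsReflection t) : cs.invParity t t = 1 := by
  obtain ⟨v, i, rfl⟩ := ht
  have h := cs.invParity_mul v⁻¹ v (cs.simple i)
  rw [inv_mul_cancel, invParity_one] at h
  rw [invParity_mul, invParity_mul]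
  have e : v⁻¹ * (v * cs.simple i * v⁻¹) * v⁻¹⁻¹ = cs.simple i := by group
  rw [e, invParity_simple]
  have e' : cs.simple i * cs.simple i * (cs.simple i)⁻¹ = cs.simple i := by simp
  rw [e', if_pos rfl, add_left_comm, add_comm (cs.invParity v⁻¹ _), ← h, add_zero]

theorem isRightInversion_of_invParity_ne_zero {w t : W} (h : cs.invParity w t ≠ 0) :
    cs.IsRightInversion w t := by
  obtain ⟨ω, hω, rfl⟩ := cs.exists_isReduced w
  exact cs.isRightInversion_of_mem_rightInvSeq hω (cs.mem_rightInvSeq_of_invParity_ne_zero ω t h)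

/-- If `w` has parity 0 at `t`, then `w t` has parity 1 there, so `t` is an inversion of `w t` and
cannot be one of `w`. -/
theorem isRightInversion_iff_invParity {w t : W} :
    cs.IsRightInversion w t ↔ cs.invParity w t = 1 := by
  refine ⟨fun h => ?_, fun h => cs.isRightInversion_of_invParity_ne_zero (by simp [h])⟩
  by_contra hne
  have h0 : cs.invParity w t = 0 := by
    generalize cs.invParity w t = z at hne
    revert z
    decide
  have h1 : cs.invParity (w * t) t = 1 := by
    rw [invParity_mul, h.1.invParity_self, mul_inv_cancel_right, h0, add_zero]
  exact h.1.isRightInversion_mul_left_iff.mp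
    (cs.isRightInversion_of_invParity_ne_zero (by simp [h1])) h

theorem ncard_rightInversions (w : W) :
    {t | cs.IsRightInversion w t}.ncard = cs.length w := by
  classical
  obtain ⟨ω, hω, rfl⟩ := cs.exists_isReduced w
  have e : {t | cs.IsRightInversion (cs.wordProd ω) t} = (cs.rightInvSeq ω).toFinset := by
    ext t
    rw [Set.mem_ofPred_eq, Finset.mem_coe, List.mem_toFinset]
    refine ⟨fun h => ?_, cs.isRightInversion_of_mem_rightInvSeq hω⟩
    rw [isRightInversion_iff_invParity] at h
    exact cs.mem_rightInvSeq_of_invParity_ne_zero ω t (by simp [h])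
  rw [e, Set.ncard_coe_finset, List.toFinset_card_of_nodup hω.nodup_rightInvSeq,
    length_rightInvSeq, hω.eq]

/-- The left weak order is inclusion of the sets of right inversions. -/
theorem exists_mul_length_add_iff (u w : W) :
    (∃ v, w = v * u ∧ cs.length w = cs.length v + cs.length u) ↔
      ∀ t, cs.IsRightInversion u t → cs.IsRightInversion w t := by
  constructor
  · rintro ⟨v, rfl, h⟩ t ⟨ht, hlt⟩
    refine ⟨ht, ?_⟩
    have := cs.length_mul_le v (u * t)
    rw [mul_assoc]
    omega
  · intro h
    induction hk : cs.length u generalizing u w with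
    | zero => exact ⟨w, by simp [cs.length_eq_zero_iff.mp hk], by simp⟩
    | succ k ih =>
      have hu : u ≠ 1 := by
        rintro rfl
        simp at hk
      obtain ⟨i, hi⟩ := cs.exists_rightDescent_of_ne_one hu
      have hw := h _ ((cs.isRightInversion_simple_iff_isRightDescent u i).mpr hi)
      rw [isRightInversion_simple_iff_isRightDescent, isRightDescent_iff] at hw
      rw [isRightDescent_iff] at hi
      -- Right multiplication by a right descent `s` removes `s` from the inversion set and
      -- conjugates the remaining inversions by `s`, so the inclusion survives.
      have hsub : ∀ t, cs.IsRightInversion (u * cs.simple i) t →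
          cs.IsRightInversion (w * cs.simple i) t := by
        intro t ht
        have key : ∀ x : W, cs.invParity (x * cs.simple i) t =
            cs.invParity (cs.simple i) t +
              cs.invParity x (cs.simple i * t * (cs.simple i)⁻¹) := fun x => cs.invParity_mul x _ t
        have hne : t ≠ cs.simple i := by
          rintro rfl
          have := ht.2
          rw [simple_mul_simple_cancel_right] at this
          omega
        rw [isRightInversion_iff_invParity, key, invParity_simple, if_neg hne, zero_add,
          ← isRightInversion_iff_invParity] at ht ⊢
        exact h _ ht
      obtain ⟨v, hv, hl⟩ := ih (u * cs.simple i) (w * cs.simple i) hsub (by omega)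
      refine ⟨v, ?_, by omega⟩
      rw [← mul_assoc] at hv
      exact mul_right_cancel hv

end CoxeterSystem

/-! ### Braid relations for two integral reflections -/

section Reflections

variable {V : Type*} [AddCommGroup V] {f g : Module.Dual ℤ V} {x y : V}

theorem Module.preReflection_mul_self (hx : f x = 2) :
    Module.preReflection x f * Module.preReflection x f = 1 := by
  ext v
  exact Module.involutive_preReflection hx v

/-- Here and in the next two results, the orders 2, 3, 4 correspond to products 0, 1, 2 of the two
pairings, the values of `4 cos² (π / m)`. For products 1 and 2 integrality leaves finitely many
pairs to check. -/
theorem Module.preReflection_mul_pow_two (hx : f x = 2) (hy : g y = 2) (hf : f y = 0)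
    (hg : g x = 0) : (Module.preReflection x f * Module.preReflection y g) ^ 2 = 1 := by
  ext v
  simp only [pow_succ, pow_zero, one_mul, Module.End.mul_apply, Module.preReflection_apply,
    map_sub, map_smul, hx, hy, hf, hg, Module.End.one_apply]
  module

theorem Module.preReflection_mul_pow_three (hx : f x = 2) (hy : g y = 2)
    (h : f y * g x = 1) : (Module.preReflection x f * Module.preReflection y g) ^ 3 = 1 := by
  ext v
  rcases Int.eq_one_or_neg_one_of_mul_eq_one' h with ⟨hf, hg⟩ | ⟨hf, hg⟩ <;>
  · simp only [pow_succ, pow_zero, one_mul, Module.End.mul_apply, Module.preReflection_apply,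
      map_sub, map_smul, hx, hy, hf, hg, Module.End.one_apply]
    module

theorem Module.preReflection_mul_pow_four (hx : f x = 2) (hy : g y = 2)
    (h : f y * g x = 2) : (Module.preReflection x f * Module.preReflection y g) ^ 4 = 1 := by
  ext v
  have hc : (f y = 1 ∧ g x = 2) ∨ (f y = 2 ∧ g x = 1) ∨ (f y = -1 ∧ g x = -2) ∨
      (f y = -2 ∧ g x = -1) := by
    have h1 : (f y).natAbs ∣ 2 := ⟨(g x).natAbs, by rw [← Int.natAbs_mul, h]; rfl⟩
    have h2 := (Nat.dvd_prime Nat.prime_two).mp h1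
    have h3 : f y = 1 ∨ f y = -1 ∨ f y = 2 ∨ f y = -2 := by omega
    rcases h3 with h3 | h3 | h3 | h3 <;> rw [h3] at h ⊢ <;> omega
  rcases hc with ⟨hf, hg⟩ | ⟨hf, hg⟩ | ⟨hf, hg⟩ | ⟨hf, hg⟩ <;>
  · simp only [pow_succ, pow_zero, one_mul, Module.End.mul_apply, Module.preReflection_apply,
      map_sub, map_smul, hx, hy, hf, hg, Module.End.one_apply]
    module

end Reflections

/-! ### The representation on quasi-periodic sequences and the reflections `refl` -/

namespace CTilde

/-- The indicator function of the residue class of `a` modulo `n`. -/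
def residueInd (n : ℕ) (a m : ℤ) : ℤ := if (n : ℤ) ∣ m - a then 1 else 0

/-- The linear functional whose kernel is the mirror of the `i`-th simple reflection. -/
def rootFun (n i : ℕ) : Module.Dual ℤ (ℤ → ℤ) where
  toFun x := if i = 0 then 2 * x 1 else if i = n then x n + x 0 else x i - x (i + 1)
  map_add' x y := by simp only [Pi.add_apply]; split_ifs <;> ring
  map_smul' c x := by
    simp only [Pi.smul_apply, smul_eq_mul, RingHom.id_apply]; split_ifs <;> ring

/-- The vector along which the `i`-th simple reflection moves points. -/
def rootVec (n i : ℕ) : ℤ → ℤ :=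
  if i = 0 then residueInd n 1
  else if i = n then residueInd n n
  else residueInd n i - residueInd n (i + 1)

variable {n : ℕ}

theorem rootFun_apply (i : ℕ) (x : ℤ → ℤ) : rootFun n i x =
    if i = 0 then 2 * x 1 else if i = n then x n + x 0 else x i - x (i + 1) := rfl

theorem residueInd_eq (hn : 0 < n) {a m : ℤ} (h1 : m - a ≤ n) (h2 : -(n : ℤ) ≤ m - a) :
    residueInd n a m = if m = a ∨ m = a + n ∨ m + n = a then 1 else 0 := by
  unfold residueInd
  congr 1
  apply propext
  constructor
  · rintro ⟨c, hc⟩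
    have hc1 : c ≤ 1 := by
      by_contra hcon
      nlinarith
    have hc2 : -1 ≤ c := by
      by_contra hcon
      nlinarith
    obtain rfl | rfl | rfl : c = -1 ∨ c = 0 ∨ c = 1 := by omega
    all_goals omega
  · rintro (h | h | h)
    · exact ⟨0, by omega⟩
    · exact ⟨1, by omega⟩
    · exact ⟨-1, by omega⟩

theorem residueInd_add (a m : ℤ) : residueInd n a (m + n) = residueInd n a m := by
  unfold residueInd
  rw [show m + (n : ℤ) - a = (m - a) + n by ring]
  simp

theorem rootVec_add (i : ℕ) (m : ℤ) : rootVec n i (m + n) = rootVec n i m := by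
  unfold rootVec
  split_ifs <;> simp [residueInd_add]

theorem rootVec_eq (hn : 0 < n) {i : ℕ} {m : ℤ} (hi : i ≤ n) (h0 : 0 ≤ m) (h1 : m ≤ n) :
    rootVec n i m =
      if i = 0 then (if m = 1 ∨ m + n = 1 ∨ m = 1 + n then 1 else 0)
      else if i = n then (if m = n ∨ m = 0 then 1 else 0)
      else (if m = i then 1 else 0) -
        (if m = i + 1 ∨ (m = 0 ∧ i + 1 = n) then 1 else 0) := by
  unfold rootVec
  by_cases c0 : i = 0
  · simp only [c0, if_true]
    rw [residueInd_eq hn (by omega) (by omega)]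
    split_ifs <;> omega
  by_cases cn : i = n
  · rw [if_neg c0, if_pos cn, if_neg c0, if_pos cn]
    rw [residueInd_eq hn (by omega) (by omega)]
    split_ifs <;> omega
  · simp only [c0, cn, if_false, Pi.sub_apply]
    rw [residueInd_eq hn (by omega) (by omega), residueInd_eq hn (by omega) (by omega)]
    split_ifs <;> omega

/-- This is the Cartan matrix up to the sign of root 0. The positive entries between 0 and 1 are
harmless, since the braid relations only involve products of opposite entries. -/
theorem rootFun_rootVec (hn : 2 ≤ n) {i j : ℕ} (hi : i ≤ n) (hj : j ≤ n) :
    rootFun n i (rootVec n j) =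
      if i = j then 2
      else if i = 0 ∧ j = 1 then 2
      else if i = 1 ∧ j = 0 then 1
      else if i = n ∧ j + 1 = n then -2
      else if i + 1 = j ∨ j + 1 = i then -1
      else 0 := by
  have h0 : 0 < n := by omega
  rw [rootFun_apply]
  by_cases c0 : i = 0
  · rw [if_pos c0, rootVec_eq h0 hj (by omega) (by omega)]
    split_ifs <;> omega
  by_cases cn : i = n
  · rw [if_neg c0, if_pos cn, rootVec_eq h0 hj (by omega) (by omega),
      rootVec_eq h0 hj (by omega) (by omega)]
    by_cases d0 : j = 0
    · repeat (first | rw [if_pos (by omega)] | rw [if_neg (by omega)])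
      norm_num
    by_cases dn : j = n
    · repeat (first | rw [if_pos (by omega)] | rw [if_neg (by omega)])
      norm_num
    rw [if_neg d0, if_neg dn, if_neg d0, if_neg dn]
    by_cases e2 : j + 1 = n
    · repeat (first | rw [if_pos (by omega)] | rw [if_neg (by omega)])
      norm_num
    · repeat (first | rw [if_pos (by omega)] | rw [if_neg (by omega)])
      norm_num
  · rw [if_neg c0, if_neg cn, rootVec_eq h0 hj (by omega) (by omega),
      rootVec_eq h0 hj (by omega) (by omega)]
    by_cases d0 : j = 0
    · subst d0
      by_cases i1 : i = 1
      · subst i1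
        repeat (first | rw [if_pos (by omega)] | rw [if_neg (by omega)])
        norm_num
      · repeat (first | rw [if_pos (by omega)] | rw [if_neg (by omega)])
        norm_num
    by_cases dn : j = n
    · rw [if_neg d0, if_pos dn, if_neg d0, if_pos dn]
      by_cases i1 : i + 1 = n
      · repeat (first | rw [if_pos (by omega)] | rw [if_neg (by omega)])
        norm_num
      · repeat (first | rw [if_pos (by omega)] | rw [if_neg (by omega)])
        norm_num
    rw [if_neg d0, if_neg dn, if_neg d0, if_neg dn]
    by_cases e1 : i = j
    · repeat (first | rw [if_pos (by omega)] | rw [if_neg (by omega)])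
      norm_num
    by_cases e2 : i + 1 = j
    · repeat (first | rw [if_pos (by omega)] | rw [if_neg (by omega)])
      norm_num
    by_cases e3 : j + 1 = i
    · repeat (first | rw [if_pos (by omega)] | rw [if_neg (by omega)])
      norm_num
    · repeat (first | rw [if_pos (by omega)] | rw [if_neg (by omega)])
      norm_num

theorem isLiftable_preReflection (hn : 2 ≤ n) :
    (coxeterMatrix n).IsLiftable fun i : Fin (n + 1) =>
      Module.preReflection (rootVec n i) (rootFun n i) := by
  intro i j
  have hi : (i : ℕ) ≤ n := by omega
  have hj : (j : ℕ) ≤ n := by omega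
  have hii := rootFun_rootVec hn hi hi
  have hjj := rootFun_rootVec hn hj hj
  have hij := rootFun_rootVec hn hi hj
  have hji := rootFun_rootVec hn hj hi
  rw [if_pos rfl] at hii hjj
  change (Module.preReflection (rootVec n i) (rootFun n i) *
    Module.preReflection (rootVec n j) (rootFun n j)) ^
    (if i = j then 1
    else if (i : ℕ) + 1 = j ∨ (j : ℕ) + 1 = i then
      (if (i : ℕ) = 0 ∨ (j : ℕ) = 0 ∨ (i : ℕ) = n ∨ (j : ℕ) = n then 4 else 3)
    else 2) = 1
  by_cases e : i = j
  · subst e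
    rw [if_pos rfl, pow_one]
    exact Module.preReflection_mul_self hii
  have e' : (i : ℕ) ≠ j := fun h => e (Fin.ext h)
  rw [if_neg e]
  split_ifs with c1 c2
  · apply Module.preReflection_mul_pow_four hii hjj
    rw [hij, hji]
    split_ifs <;> omega
  · apply Module.preReflection_mul_pow_three hii hjj
    rw [hij, hji]
    split_ifs <;> omega
  · apply Module.preReflection_mul_pow_two hii hjj
    · rw [hij]
      split_ifs <;> omega
    · rw [hji]
      split_ifs <;> omega

/-- The linear representation of `C̃ₙ` on functions `ℤ → ℤ`. -/
noncomputable def rep (hn : 2 ≤ n) : W n →* Module.End ℤ (ℤ → ℤ) :=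
  (cs n).lift ⟨_, isLiftable_preReflection hn⟩

theorem rep_s (hn : 2 ≤ n) (i : Fin (n + 1)) :
    rep hn (s i) = Module.preReflection (rootVec n i) (rootFun n i) :=
  (cs n).lift_apply_simple (isLiftable_preReflection hn) i

/-- The generator `sᵢ` for a natural number `i`, extended by `1`. -/
def sNat (n i : ℕ) : W n := if h : i < n + 1 then s ⟨i, h⟩ else 1

/-- The product `sₖ₋₁ ⋯ s₀`. -/
def descProd (n : ℕ) : ℕ → W n
  | 0 => 1
  | k + 1 => sNat n k * descProd n k

/-- The Coxeter element `sₙ ⋯ s₀`. -/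
def coxElt (n : ℕ) : W n := descProd n (n + 1)

theorem rep_sNat (hn : 2 ≤ n) {i : ℕ} (hi : i ≤ n) (x : ℤ → ℤ) :
    rep hn (sNat n i) x = x - rootFun n i x • rootVec n i := by
  rw [sNat, dif_pos (by omega), rep_s, Module.preReflection_apply]

/-- Functions with `x (m + n) = x m + N`. -/
def QuasiPeriodic (n : ℕ) (N : ℤ) (x : ℤ → ℤ) : Prop := ∀ m, x (m + n) = x m + N

/-- Every root vector is `n`-periodic. On this space `x 0 = x n - N`, so `sₙ` acts on the window `1,
…, n` by the affine reflection `x n ↦ N - x n`, while the action on all sequences stays linear. -/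
theorem QuasiPeriodic.rep {N : ℤ} {x : ℤ → ℤ} (hn : 2 ≤ n) (hx : QuasiPeriodic n N x) (w : W n) :
    QuasiPeriodic n N (rep hn w x) := by
  induction w using (cs n).simple_induction_left with
  | one => simpa using hx
  | mul_simple_left w i ih =>
    intro m
    have e : CTilde.rep hn ((cs n).simple i * w) x =
        CTilde.rep hn w x - rootFun n i (CTilde.rep hn w x) • rootVec n i := by
      rw [map_mul, Module.End.mul_apply]
      change CTilde.rep hn (s i) _ = _
      rw [rep_s, Module.preReflection_apply]
    rw [e]
    simp only [Pi.sub_apply, Pi.smul_apply, rootVec_add, ih m]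
    ring

theorem QuasiPeriodic.ext {N : ℤ} {x y : ℤ → ℤ} (hn : 0 < n) (hx : QuasiPeriodic n N x)
    (hy : QuasiPeriodic n N y) (h : ∀ m : ℤ, 1 ≤ m → m ≤ n → x m = y m) : x = y := by
  have key : ∀ (z : ℤ → ℤ), QuasiPeriodic n N z → ∀ (m q : ℤ), z (m + n * q) = z m + q * N := by
    intro z hz m q
    induction q with
    | zero => simp
    | succ q ih =>
      have := hz (m + n * q)
      rw [show m + (n : ℤ) * (q + 1) = m + n * q + n by ring, this, ih]
      ring
    | pred q ih =>
      have := hz (m + n * (-q - 1))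
      rw [show m + (n : ℤ) * (-q - 1) + n = m + n * -q by ring, ih] at this
      linear_combination -this
  funext m
  have e := Int.emod_add_mul_ediv (m - 1) n
  have h1 := Int.emod_nonneg (m - 1) (b := n) (by omega)
  have h2 := Int.emod_lt_of_pos (m - 1) (b := n) (by omega)
  have e' : m = ((m - 1) % n + 1) + n * ((m - 1) / n) := by linarith
  rw [e', key x hx, key y hy, h _ (by omega) (by omega)]

/-- `s₀` negates the entry at place 1, and the transpositions that follow carry it to place `k`,
moving the entries between down by one. -/
theorem rep_descProd_apply {x : ℤ → ℤ} (hn : 2 ≤ n) {k : ℕ} (hk : k ≤ n) {m : ℤ} (h1 : 1 ≤ m) (h2 : m ≤ n) :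
    rep hn (descProd n k) x m = if m < k then x (m + 1) else if m = k then -x 1 else x m := by
  induction k generalizing m with
  | zero =>
    rw [if_neg (by omega), if_neg (by omega)]
    simp [descProd]
  | succ k ih =>
    rw [descProd, map_mul, Module.End.mul_apply, rep_sNat hn (by omega), Pi.sub_apply,
      Pi.smul_apply, smul_eq_mul, ih (by omega) h1 h2, rootFun_apply,
      rootVec_eq (by omega) (by omega) (by omega) (by omega)]
    by_cases c0 : k = 0
    · subst c0
      rw [if_pos rfl, if_pos rfl, ih (by omega) le_rfl (by omega)]
      by_cases cm : m = 1
      · subst cm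
        norm_num
        ring
      · have : ¬ (m + n = 1) := by omega
        have : ¬ (m < 1) := by omega
        have : ¬ (m < 0) := by omega
        have : ¬ (m = 0) := by omega
        have : ¬ (m = 1 + n) := by omega
        simp [*]
    · have ek := ih (m := k) (by omega) (by omega) (by omega)
      have ek1 := ih (m := k + 1) (by omega) (by omega) (by omega)
      rw [if_neg (by omega), if_pos rfl] at ek
      rw [if_neg (by omega), if_neg (by omega)] at ek1
      rw [if_neg c0, ek]
      rcases lt_trichotomy m k with c | c | c
      · repeat (first | rw [if_pos (by omega)] | rw [if_neg (by omega)])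
        ring
      · subst c
        repeat (first | rw [if_pos (by omega)] | rw [if_neg (by omega)])
        rw [ek1]
        ring
      · by_cases c' : m = k + 1
        · subst c'
          repeat (first | rw [if_pos (by omega)] | rw [if_neg (by omega)])
          rw [ek1]
          ring
        · repeat (first | rw [if_pos (by omega)] | rw [if_neg (by omega)])
          ring

/-- After `sₙ₋₁ ⋯ s₀` place `n` holds `-x 1`; the last reflection turns this into `N + x 1 = x (n +
1)`, which completes the shift. -/
theorem rep_coxElt {N : ℤ} {x : ℤ → ℤ} (hn : 2 ≤ n) (hx : QuasiPeriodic n N x) :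
    rep hn (coxElt n) x = fun m => x (m + 1) := by
  refine QuasiPeriodic.ext (n := n) (by omega) (hx.rep hn _) ?_ ?_
  · intro m
    have := hx (m + 1)
    rwa [show m + 1 + (n : ℤ) = m + n + 1 by ring] at this
  · intro m h1 h2
    have hq := hx.rep hn (descProd n n) 0
    rw [zero_add] at hq
    have hq1 := hx 1
    rw [coxElt, descProd, map_mul, Module.End.mul_apply, rep_sNat hn le_rfl, Pi.sub_apply,
      Pi.smul_apply, smul_eq_mul, rootFun_apply, if_neg (by omega), if_pos rfl,
      rootVec_eq (by omega) le_rfl (by omega) (by omega), if_neg (by omega), if_pos rfl,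
      rep_descProd_apply hn le_rfl h1 h2]
    rw [rep_descProd_apply hn le_rfl (by omega) le_rfl] at hq ⊢
    simp only [lt_irrefl, if_false, if_true] at hq ⊢
    rcases h2.lt_or_eq with c | rfl
    · rw [if_pos c, if_neg (by omega)]
      ring
    · simp only [lt_irrefl, if_false, if_true, true_or]
      rw [add_comm (n : ℤ) 1, hq1]
      linarith

theorem rep_coxElt_pow {N : ℤ} {x : ℤ → ℤ} (hn : 2 ≤ n) (hx : QuasiPeriodic n N x) (j : ℕ) :
    rep hn (coxElt n ^ j) x = fun m => x (m + j) := by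
  induction j with
  | zero => simp
  | succ j ih =>
    rw [pow_succ', map_mul, Module.End.mul_apply, rep_coxElt hn (hx.rep hn _), ih]
    funext m
    exact congrArg x (by push_cast; ring)

/-- The reflection `c⁻ʲ (s₀ ⋯ sₖ₋₁ sₖ sₖ₋₁ ⋯ s₀) cʲ`, where `c` is the Coxeter element. -/
def refl (n k j : ℕ) : W n :=
  (descProd n k * coxElt n ^ j)⁻¹ * sNat n k * (descProd n k * coxElt n ^ j)

/-- The vector along which `refl n k j` moves points. -/
def reflVec (n k j : ℕ) (m : ℤ) : ℤ :=
  residueInd n (j + 1) m + if k = 0 ∨ k = n then 0 else residueInd n (j + 1 + k) m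

theorem quasiPeriodic_reflVec (n k j : ℕ) : QuasiPeriodic n 0 (reflVec n k j) := by
  intro m
  simp [reflVec, residueInd_add]

theorem reflVec_zero_eq (hn : 0 < n) {k : ℕ} (hk : k ≤ n) {m : ℤ} (h1 : 1 ≤ m) (h2 : m ≤ n) :
    reflVec n k 0 m = if m = 1 ∨ (m = k + 1 ∧ k ≠ n) then 1 else 0 := by
  unfold reflVec
  rw [residueInd_eq (by omega) (by omega) (by omega)]
  by_cases c : k = 0 ∨ k = n
  · rw [if_pos c]
    split_ifs <;> omega
  · rw [if_neg c, residueInd_eq (by omega) (by omega) (by omega)]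
    split_ifs <;> omega

theorem rep_descProd_reflVec (hn : 2 ≤ n) {k : ℕ} (hk : k ≤ n) :
    rep hn (descProd n k) (reflVec n k 0) = (if k = 0 then 1 else -1 : ℤ) • rootVec n k := by
  have hv0 := quasiPeriodic_reflVec n k 0
  refine (hv0.rep hn _).ext (by omega) ?_ ?_
  · intro m
    simp [rootVec_add]
  · intro m h1 h2
    have v1 := reflVec_zero_eq (by omega) hk h1 h2
    have v2 := reflVec_zero_eq (n := n) (m := 1) (by omega) hk (by omega) (by omega)
    rw [rep_descProd_apply hn hk h1 h2, Pi.smul_apply, smul_eq_mul,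
      rootVec_eq (by omega) hk (by omega) h2]
    rcases lt_trichotomy m k with c | c | c
    · have v3 := reflVec_zero_eq (n := n) (m := m + 1) (by omega) hk (by omega) (by omega)
      rw [if_pos c, v3]
      repeat (first | rw [if_pos (by omega)] | rw [if_neg (by omega)])
      by_cases kn : k = n
      · repeat (first | rw [if_pos (by omega)] | rw [if_neg (by omega)])
        norm_num
      · repeat (first | rw [if_pos (by omega)] | rw [if_neg (by omega)])
        norm_num
    · subst c
      rw [v2]
      repeat (first | rw [if_pos (by omega)] | rw [if_neg (by omega)])
      by_cases kn : k = n
      · repeat rw [if_pos (by omega)]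
        norm_num
      · repeat (first | rw [if_pos (by omega)] | rw [if_neg (by omega)])
        norm_num
    · rw [v1]
      by_cases k0 : k = 0
      · subst k0
        split_ifs <;> omega
      by_cases c' : m = k + 1
      · repeat (first | rw [if_pos (by omega)] | rw [if_neg (by omega)])
        norm_num
      · repeat (first | rw [if_pos (by omega)] | rw [if_neg (by omega)])
        norm_num

theorem rootFun_rep_descProd {N : ℤ} {x : ℤ → ℤ} (hn : 2 ≤ n) (hx : QuasiPeriodic n N x) {k : ℕ}
    (hk : k ≤ n) : rootFun n k (rep hn (descProd n k) x) =
      (if k = 0 then 1 else -1 : ℤ) * (x 1 + x (1 + k)) := by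
  have hq := hx.rep hn (descProd n k) 0
  have hq1 := hx 1
  rw [zero_add] at hq
  rw [rootFun_apply]
  by_cases k0 : k = 0
  · subst k0
    simp [descProd]
    ring
  have ek := rep_descProd_apply (x := x) hn hk (m := k) (by omega) (by omega)
  rw [if_neg (by omega), if_pos rfl] at ek
  rw [if_neg k0, if_neg k0]
  by_cases kn : k = n
  · subst kn
    rw [if_pos rfl, hq1]
    linarith
  · have ek1 := rep_descProd_apply (x := x) hn hk (m := k + 1) (by omega) (by omega)
    rw [if_neg (by omega), if_neg (by omega)] at ek1
    rw [if_neg kn, ek, ek1, add_comm (k : ℤ) 1]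
    ring

/-- The element `descProd n k` carries `reflVec n k 0` to the simple root vector and pulls the root
functional back to `x 1 + x (1 + k)`, both up to the same sign, which cancels. The power of `c`
shifts indices by `j`. -/
theorem rep_refl {N : ℤ} {x : ℤ → ℤ} (hn : 2 ≤ n) (hx : QuasiPeriodic n N x) {k : ℕ}
    (hk : k ≤ n) (j : ℕ) :
    rep hn (refl n k j) x = x - (x (j + 1) + x (j + 1 + k)) • reflVec n k j := by
  set p := descProd n k * coxElt n ^ j with hp
  -- The identity is compared after applying `p`, where the conjugated reflection becomes the simple
  -- one.
  have hinj : Function.Injective (rep hn p) := by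
    intro y z h
    have := congrArg (rep hn p⁻¹) h
    simpa only [← Module.End.mul_apply, ← map_mul, inv_mul_cancel, map_one,
      Module.End.one_apply] using this
  apply hinj
  rw [map_sub, map_smul, ← Module.End.mul_apply, ← map_mul]
  have e : p * refl n k j = sNat n k * p := by
    rw [refl, ← hp]
    group
  have hsx : QuasiPeriodic n N (fun m => x (m + j)) := by
    intro m
    have := hx (m + j)
    rwa [show m + (j : ℤ) + n = m + n + j by ring] at this
  have hs : (fun m : ℤ => reflVec n k j (m + j)) = reflVec n k 0 := by
    funext m
    unfold reflVec residueInd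
    rw [show m + (j : ℤ) - (j + 1) = m - ((0 : ℕ) + 1) by push_cast; ring,
      show m + (j : ℤ) - (j + 1 + k) = m - ((0 : ℕ) + 1 + k) by push_cast; ring]
  have ex : rep hn p x = rep hn (descProd n k) (fun m => x (m + j)) := by
    rw [hp, map_mul, Module.End.mul_apply, rep_coxElt_pow hn hx]
  have ev : rep hn p (reflVec n k j) = rep hn (descProd n k) (reflVec n k 0) := by
    rw [hp, map_mul, Module.End.mul_apply, rep_coxElt_pow hn (quasiPeriodic_reflVec n k j), hs]
  rw [e, map_mul, Module.End.mul_apply, rep_sNat hn hk, ex, ev]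
  rw [rep_descProd_reflVec hn hk, rootFun_rep_descProd hn hsx hk, smul_smul,
    show (1 : ℤ) + k + j = j + 1 + k by ring, add_comm 1 (j : ℤ), mul_comm]

/-- Acting on the constant sequence 1 recovers the vector `reflVec`; acting on `m ↦ m` then recovers
its coefficient, hence `2 * j + k`. -/
theorem refl_injective (hn : 2 ≤ n) {k k' j j' : ℕ} (hk : k ≤ n) (hk' : k' ≤ n)
    (h : refl n k j = refl n k' j') : k = k' ∧ j = j' := by
  have q1 : QuasiPeriodic n 0 (fun _ => 1) := fun m => by simp
  have q2 : QuasiPeriodic n n (fun m => m) := fun m => rfl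
  have hpos : reflVec n k j (j + 1) ≠ 0 := by
    unfold reflVec residueInd
    split_ifs <;> simp_all
  have e1 : reflVec n k j = reflVec n k' j' := by
    have h1 := rep_refl hn q1 hk j
    rw [h, rep_refl hn q1 hk' j'] at h1
    funext m
    have := congrFun h1 m
    simp only [Pi.sub_apply, Pi.smul_apply, smul_eq_mul] at this
    linarith
  have e2 : 2 * j + k = 2 * j' + k' := by
    have h1 := rep_refl hn q2 hk j
    rw [h, rep_refl hn q2 hk' j', e1] at h1
    have := congrFun h1 (j + 1)
    simp only [Pi.sub_apply, Pi.smul_apply, smul_eq_mul, sub_right_inj] at this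
    rw [← e1] at this
    have := mul_right_cancel₀ hpos this
    omega
  rw [e1] at hpos
  -- The residue of `j + 1` lies in the support of the common vector. Given `2 * j + k = 2 * j' +
  -- k'` and `k, k' ≤ n`, the first case forces `j = j'`, and the second forces `k = k' = 0` or `k =
  -- k' = n`.
  have hd : (n : ℤ) ∣ (j : ℤ) - j' ∨ (n : ℤ) ∣ (j : ℤ) - j' - k' := by
    by_contra hcon
    rw [not_or] at hcon
    apply hpos
    unfold reflVec residueInd
    rw [show (j : ℤ) + 1 - (j' + 1) = j - j' by ring,
      show (j : ℤ) + 1 - (j' + 1 + k') = j - j' - k' by ring, if_neg hcon.1, if_neg hcon.2]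
    simp
  rcases hd with ⟨q, hq⟩ | ⟨q, hq⟩
  · have h1 : q < 1 := by
      by_contra hcon
      nlinarith
    have h2 : -1 < q := by
      by_contra hcon
      nlinarith
    obtain rfl : q = 0 := by omega
    omega
  · have h1 : q < 1 := by
      by_contra hcon
      nlinarith
    have h2 : -2 < q := by
      by_contra hcon
      nlinarith
    obtain rfl | rfl : q = 0 ∨ q = -1 := by omega
    all_goals omega

end CTilde

/-! ### Inversion sets and lengths of the words `a^ε` -/

namespace CTilde

variable {n : ℕ}

theorem sNat_commute {i q : ℕ} (hi : i ≤ n) (h : q + 1 < i) : Commute (sNat n i) (sNat n q) := by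
  rw [sNat, dif_pos (by omega), sNat, dif_pos (by omega)]
  set i' : Fin (n + 1) := ⟨i, by omega⟩
  set q' : Fin (n + 1) := ⟨q, by omega⟩
  have hM : coxeterMatrix n i' q' = 2 := by
    change (if i' = q' then 1
      else if i + 1 = q ∨ q + 1 = i then
        (if i = 0 ∨ q = 0 ∨ i = n ∨ q = n then 4 else 3)
      else 2) = 2
    rw [if_neg (by simp [i', q', Fin.ext_iff]; omega), if_neg (by omega)]
  have h2 := (cs n).simple_mul_simple_pow i' q'
  rw [hM, pow_two, mul_eq_one_iff_eq_inv, mul_inv_rev, CoxeterSystem.inv_simple,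
    CoxeterSystem.inv_simple] at h2
  exact h2

/-- The cofactor is `sₙ ⋯ sₖ`, whose indices are all at distance at least 2 from such `q`. -/
theorem exists_coxElt_eq_mul_descProd {k : ℕ} (hk : k ≤ n + 1) :
    ∃ d, coxElt n = d * descProd n k ∧ ∀ q, q + 1 < k → Commute d (sNat n q) := by
  have key : ∀ m, k ≤ m → m ≤ n + 1 →
      ∃ d, descProd n m = d * descProd n k ∧ ∀ q, q + 1 < k → Commute d (sNat n q) := by
    intro m hm
    induction m, hm using Nat.le_induction with
    | base => exact fun _ => ⟨1, by simp, fun _ _ => Commute.one_left _⟩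
    | succ m hm ih =>
      intro hm'
      obtain ⟨d, hd, hc⟩ := ih (by omega)
      refine ⟨sNat n m * d, by rw [descProd, hd, mul_assoc], fun q hq => ?_⟩
      exact (sNat_commute (by omega) (by omega)).mul_left (hc q hq)
  exact key (n + 1) hk le_rfl

theorem commute_descProd {z : W n} {k : ℕ} (hz : ∀ q < k, Commute z (sNat n q)) :
    Commute z (descProd n k) := by
  induction k with
  | zero => exact Commute.one_right _
  | succ k ih =>
    exact (hz k (by omega)).mul_right (ih fun q hq => hz q (by omega))

theorem refl_eq_conj (k j : ℕ) : refl n k j = (coxElt n ^ j)⁻¹ * refl n k 0 * coxElt n ^ j := by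
  simp only [refl, pow_zero, mul_one]
  group

open scoped Classical in
theorem invParity_descProd {k : ℕ} (hk : k ≤ n + 1) (r : W n) :
    (cs n).invParity (descProd n k) r = ∑ i ∈ Finset.range k, if r = refl n i 0 then 1 else 0 := by
  induction k with
  | zero => simp [descProd]
  | succ k ih =>
    have e : sNat n k = (cs n).simple ⟨k, by omega⟩ := by
      rw [sNat, dif_pos (by omega)]
      rfl
    rw [descProd, CoxeterSystem.invParity_mul, ih (by omega), Finset.sum_range_succ, e,
      CoxeterSystem.invParity_simple, ← e]
    congr 2
    rw [refl, pow_zero, mul_one, mul_inv_eq_iff_eq_mul, mul_assoc, eq_inv_mul_iff_mul_eq]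

/-- `refl n i 0` is a word in `s₀, …, sᵢ`, so `z` commutes with it; conjugation by `V` and by `c^T`
therefore pull it back to the same reflection. -/
theorem conj_eq_refl_iff {z V : W n} {k T i : ℕ} (hV : coxElt n ^ T = z * V)
    (hz : ∀ q < k, Commute z (sNat n q)) (hi : i < k) (t : W n) :
    V * t * V⁻¹ = refl n i 0 ↔ t = refl n i T := by
  have hd : Commute z (descProd n i) := commute_descProd fun q hq => hz q (by omega)
  have hr : Commute z (refl n i 0) := by
    rw [refl, pow_zero, mul_one]
    exact (hd.inv_right.mul_right (hz i hi)).mul_right hd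
  rw [refl_eq_conj i T, hV, mul_inv_rev, mul_assoc V⁻¹, hr.inv_left.eq, mul_inv_eq_iff_eq_mul, mul_assoc, ← eq_inv_mul_iff_mul_eq]
  simp [mul_assoc]

-- Prefixing `sₖ₋₁ ⋯ s₀` adds a row of boxes at height `T` in the columns `0, …, k - 1`.
open scoped Classical in
theorem invParity_descProd_mul {z V : W n} {k T : ℕ} (hk : k ≤ n + 1)
    (hV : coxElt n ^ T = z * V) (hz : ∀ q < k, Commute z (sNat n q)) (t : W n) :
    (cs n).invParity (descProd n k * V) t =
      (cs n).invParity V t + ∑ i ∈ Finset.range k, if t = refl n i T then 1 else 0 := by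
  rw [CoxeterSystem.invParity_mul, invParity_descProd hk]
  congr 1
  refine Finset.sum_congr rfl fun i hi => ?_
  simp only [conj_eq_refl_iff hV hz (Finset.mem_range.mp hi)]

open scoped Classical in
theorem invParity_coxElt_pow (e : ℕ) (t : W n) :
    (cs n).invParity (coxElt n ^ e) t = ∑ i ∈ Finset.range (n + 1), ∑ j ∈ Finset.range e,
      if t = refl n i j then 1 else 0 := by
  induction e with
  | zero => simp
  | succ e ih =>
    rw [pow_succ', coxElt, invParity_descProd_mul (z := 1) (T := e) le_rfl (by simp [coxElt])
      (fun _ _ => Commute.one_left _), ← coxElt, ih, ← Finset.sum_add_distrib]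
    simp only [Finset.sum_range_succ]

theorem a_eq_descProd (i : Fin (n + 1)) : a i = descProd n (i + 1) := by
  induction i using Fin.induction with
  | zero => simp [a, descProd, sNat]
  | succ i ih =>
    have e : a i.succ = s i.succ * a i.castSucc := rfl
    rw [e, ih, descProd]
    congr 1
    simp [sNat]
    rfl

theorem tail_eq_add (ε : Fin (n + 1) → ℕ) {k : ℕ} (hk : k < n + 1) :
    tail ε k = tail ε (k + 1) + ε ⟨k, hk⟩ := by
  unfold tail
  have : (Finset.univ.filter fun i : Fin (n + 1) => k ≤ (i : ℕ)) =
      insert ⟨k, hk⟩ (Finset.univ.filter fun i : Fin (n + 1) => k + 1 ≤ (i : ℕ)) := by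
    ext i
    simp [Fin.ext_iff]
    omega
  rw [this, Finset.sum_insert (by simp), add_comm]

theorem tail_of_lt (ε : Fin (n + 1) → ℕ) {k : ℕ} (hk : n < k) : tail ε k = 0 := by
  unfold tail
  refine Finset.sum_eq_zero fun i hi => ?_
  have := (Finset.mem_filter.mp hi).2
  omega

/-- The product `aₖ ^ εₖ * ⋯ * aₙ ^ εₙ`. -/
def suffix (ε : Fin (n + 1) → ℕ) (k : ℕ) : W n := ((List.ofFn fun i => a i ^ ε i).drop k).prod

theorem suffix_zero (ε : Fin (n + 1) → ℕ) : suffix ε 0 = word ε := by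
  simp [suffix, word]

theorem suffix_eq_mul (ε : Fin (n + 1) → ℕ) {k : ℕ} (hk : k < n + 1) :
    suffix ε k = a ⟨k, hk⟩ ^ ε ⟨k, hk⟩ * suffix ε (k + 1) := by
  rw [suffix, List.drop_eq_getElem_cons (by simpa using hk), List.prod_cons, List.getElem_ofFn]
  rfl

theorem suffix_last (ε : Fin (n + 1) → ℕ) : suffix ε n = coxElt n ^ tail ε n := by
  rw [suffix_eq_mul ε (Nat.lt_succ_self n), a_eq_descProd, tail_eq_add ε (Nat.lt_succ_self n),
    tail_of_lt ε (Nat.lt_succ_self n), zero_add]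
  have h : suffix ε (n + 1) = 1 := by
    rw [suffix, List.drop_eq_nil_of_le (by simp), List.prod_nil]
  rw [h, mul_one]
  rfl

-- Descending induction on `k`, with the commuting cofactor `z` carried along so that the next row
-- lands at height `tail ε (k + 1)`. The index `max i k` says that the columns up to `k` all have
-- the height of column `k` so far.
open scoped Classical in
theorem exists_coxElt_pow_eq_mul_suffix {ε : Fin (n + 1) → ℕ} (hε : Admissible ε) {k : ℕ}
    (hk : k ≤ n) :
    (∃ z, coxElt n ^ tail ε k = z * suffix ε k ∧ ∀ q < k, Commute z (sNat n q)) ∧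
    ∀ t, (cs n).invParity (suffix ε k) t = ∑ i ∈ Finset.range (n + 1),
      ∑ j ∈ Finset.range (tail ε (max i k)), if t = refl n i j then 1 else 0 := by
  induction hk using Nat.decreasingInduction with
  | self =>
    -- Since `aₙ = c`, the last factor is itself a power of `c` and no cofactor is needed.
    refine ⟨⟨1, by rw [suffix_last, one_mul], fun _ _ => Commute.one_left _⟩, fun t => ?_⟩
    rw [suffix_last, invParity_coxElt_pow]
    refine Finset.sum_congr rfl fun i hi => ?_
    rw [max_eq_right (by simpa [Nat.lt_succ_iff] using hi)]
  | of_succ k hk ih =>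
    obtain ⟨⟨z, hz, hc⟩, hp⟩ := ih
    have hk' : k < n + 1 := by omega
    have hle := hε.1 ⟨k, hk'⟩ hk
    have ht := tail_eq_add ε hk'
    rw [suffix_eq_mul ε hk', ht]
    have hmax : ∀ i, k < i → max i (k + 1) = max i k := fun i hi => by omega
    obtain h0 | h1 : ε ⟨k, hk'⟩ = 0 ∨ ε ⟨k, hk'⟩ = 1 := by omega
    · rw [h0, add_zero] at ht
      rw [h0, pow_zero, one_mul, add_zero]
      refine ⟨⟨z, hz, fun q hq => hc q (by omega)⟩, fun t => ?_⟩
      rw [hp]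
      refine Finset.sum_congr rfl fun i _ => ?_
      rcases le_or_gt i k with h | h
      · rw [max_eq_right h, max_eq_right (by omega), ht]
      · rw [hmax i h]
    · rw [h1] at ht
      rw [h1, pow_one, a_eq_descProd]
      constructor
      · obtain ⟨d, hd, hdc⟩ := exists_coxElt_eq_mul_descProd (n := n) (k := k + 1) (by omega)
        -- `c · c^T = d aₖ z V = (d z) (aₖ V)`, as `z` commutes with `s₀, …, sₖ`. The factor `d`
        -- commutes only with `s_q` for `q < k`, so each step loses one index.
        refine ⟨d * z, ?_, fun q hq => (hdc q (by omega)).mul_left (hc q (by omega))⟩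
        rw [pow_succ', hz, hd]
        simp only [mul_assoc]
        rw [← mul_assoc z, (commute_descProd hc).eq, mul_assoc]
      · intro t
        rw [invParity_descProd_mul (by omega) hz hc, hp]
        rw [← Finset.sum_range_add_sum_Ico _ (show k + 1 ≤ n + 1 by omega),
          ← Finset.sum_range_add_sum_Ico _ (show k + 1 ≤ n + 1 by omega), add_right_comm]
        congr 1
        · rw [← Finset.sum_add_distrib]
          refine Finset.sum_congr rfl fun i hi => ?_
          have hi' := Finset.mem_range.mp hi
          rw [max_eq_right (by omega), max_eq_right (by omega), ht, Finset.sum_range_succ]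
        · refine Finset.sum_congr rfl fun i hi => ?_
          rw [hmax i (by have := Finset.mem_Ico.mp hi; omega)]

/-- Distinct boxes are distinct reflections, so no two terms of the parity sum cancel. -/
theorem isRightInversion_word_iff (hn : 2 ≤ n) {ε : Fin (n + 1) → ℕ} (hε : Admissible ε) (t : W n) :
    (cs n).IsRightInversion (word ε) t ↔ ∃ i ≤ n, ∃ j < tail ε i, t = refl n i j := by
  classical
  rw [CoxeterSystem.isRightInversion_iff_invParity, ← suffix_zero,
    (exists_coxElt_pow_eq_mul_suffix hε (Nat.zero_le n)).2]
  simp only [Nat.max_zero]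
  constructor
  · intro h
    obtain ⟨i, hi, h⟩ := Finset.exists_ne_zero_of_sum_ne_zero (h.trans_ne one_ne_zero)
    obtain ⟨j, hj, h⟩ := Finset.exists_ne_zero_of_sum_ne_zero h
    refine ⟨i, by simpa [Nat.lt_succ_iff] using hi, j, by simpa using hj, ?_⟩
    by_contra hne
    exact h (if_neg hne)
  · rintro ⟨i, hi, j, hj, rfl⟩
    rw [Finset.sum_eq_single_of_mem i (by simpa [Nat.lt_succ_iff] using hi),
      Finset.sum_eq_single_of_mem j (by simpa using hj), if_pos rfl]
    · exact fun j' _ hne => if_neg fun h => hne (refl_injective hn hi hi h).2.symm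
    · intro i' hi' hne
      refine Finset.sum_eq_zero fun j' _ => if_neg fun h => hne ?_
      exact (refl_injective hn hi (by simpa [Nat.lt_succ_iff] using hi') h).1.symm

theorem len_word (hn : 2 ≤ n) {ε : Fin (n + 1) → ℕ} (hε : Admissible ε) :
    len (word ε) = ∑ i ∈ Finset.range (n + 1), tail ε i := by
  classical
  have e : {t | (cs n).IsRightInversion (word ε) t} =
      (((Finset.range (n + 1)).sigma fun i => Finset.range (tail ε i)).image
        fun p => refl n p.1 p.2 : Finset (W n)) := by
    ext t
    rw [Set.mem_ofPred_eq, isRightInversion_word_iff hn hε, Finset.mem_coe, Finset.mem_image]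
    constructor
    · rintro ⟨i, hi, j, hj, rfl⟩
      exact ⟨⟨i, j⟩, by simp [hi, hj], rfl⟩
    · rintro ⟨⟨i, j⟩, h, rfl⟩
      simp only [Finset.mem_sigma, Finset.mem_range, Nat.lt_succ_iff] at h
      exact ⟨i, h.1, j, h.2, rfl⟩
  rw [len, ← CoxeterSystem.ncard_rightInversions, e, Set.ncard_coe_finset, Finset.card_image_of_injOn,
    Finset.card_sigma]
  · simp
  · rintro ⟨i, j⟩ h ⟨i', j'⟩ h' heq
    simp only [Finset.mem_coe, Finset.mem_sigma, Finset.mem_range, Nat.lt_succ_iff] at h h'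
    obtain ⟨rfl, rfl⟩ := refl_injective hn h.1 h'.1 heq
    rfl

end CTilde

/-! ### Dominance, and meets and joins in the whole group -/

namespace CTilde

variable {n : ℕ}

theorem le_iff_isRightInversion (u w : W n) :
    u ≤ w ↔ ∀ t, (cs n).IsRightInversion u t → (cs n).IsRightInversion w t :=
  (cs n).exists_mul_length_add_iff u w

theorem word_le_word_iff (hn : 2 ≤ n) {ε δ : Fin (n + 1) → ℕ} (hε : Admissible ε)
    (hδ : Admissible δ) : word ε ≤ word δ ↔ ∀ k ≤ n, tail ε k ≤ tail δ k := by
  simp only [le_iff_isRightInversion, isRightInversion_word_iff hn hε,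
    isRightInversion_word_iff hn hδ]
  constructor
  · intro h k hk
    by_contra hlt
    obtain ⟨i, hi, j, hj, he⟩ := h _ ⟨k, hk, tail δ k, by omega, rfl⟩
    obtain ⟨rfl, rfl⟩ := refl_injective hn hk hi he
    exact lt_irrefl _ hj
  · rintro h t ⟨i, hi, j, hj, rfl⟩
    exact ⟨i, hi, j, hj.trans_le (h i hi), rfl⟩

theorem eq_of_tail_eq {ε δ : Fin (n + 1) → ℕ} (h : ∀ k ≤ n, tail ε k = tail δ k) : ε = δ := by
  funext k
  have h1 := tail_eq_add ε k.2
  have h2 := tail_eq_add δ k.2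
  have h3 := h k (by omega)
  have h4 : tail ε (k + 1) = tail δ (k + 1) := by
    rcases Nat.lt_or_ge n (k + 1) with hk | hk
    · rw [tail_of_lt ε hk, tail_of_lt δ hk]
    · exact h _ hk
  simp only [Fin.eta] at h1 h2
  omega

theorem tail_le_of_admissible {ε : Fin (n + 1) → ℕ} (hε : Admissible ε) {k : ℕ} (hk : k < n) :
    tail ε (k + 1) ≤ tail ε k ∧ tail ε k ≤ tail ε (k + 1) + 1 := by
  have h1 := tail_eq_add ε (show k < n + 1 by omega)
  have h2 := hε.1 ⟨k, by omega⟩ hk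
  omega

theorem tail_last (ε : Fin (n + 1) → ℕ) : tail ε n = ε (Fin.last n) := by
  rw [tail_eq_add ε (Nat.lt_succ_self n), tail_of_lt ε (Nat.lt_succ_self n), zero_add]
  rfl

theorem tail_sub {f : ℕ → ℕ} (hf : ∀ k ≤ n, f (k + 1) ≤ f k) (h0 : f (n + 1) = 0) {k : ℕ}
    (hk : k ≤ n) : tail (fun i : Fin (n + 1) => f i - f (i + 1)) k = f k := by
  induction hk using Nat.decreasingInduction with
  | self => simp [tail_last, h0]
  | of_succ k hk ih =>
    have := hf k hk.le
    rw [tail_eq_add _ (by omega), ih]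
    dsimp only
    omega

theorem tail_succ_le (ε : Fin (n + 1) → ℕ) {k : ℕ} (hk : k ≤ n) : tail ε (k + 1) ≤ tail ε k := by
  rw [tail_eq_add ε (Nat.lt_succ_of_le hk)]
  exact Nat.le_add_right _ _

section MeetJoin

variable {ε δ : Fin (n + 1) → ℕ}

theorem tail_meetExp (ε δ : Fin (n + 1) → ℕ) {k : ℕ} (hk : k ≤ n) :
    tail (meetExp ε δ) k = min (tail ε k) (tail δ k) := by
  refine tail_sub (f := fun k => min (tail ε k) (tail δ k)) (fun k hk => ?_) ?_ hk
  · have := tail_succ_le ε hk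
    have := tail_succ_le δ hk
    omega
  · simp [tail_of_lt]

theorem tail_joinExp (ε δ : Fin (n + 1) → ℕ) {k : ℕ} (hk : k ≤ n) :
    tail (joinExp ε δ) k = max (tail ε k) (tail δ k) := by
  refine tail_sub (f := fun k => max (tail ε k) (tail δ k)) (fun k hk => ?_) ?_ hk
  · have := tail_succ_le ε hk
    have := tail_succ_le δ hk
    omega
  · simp [tail_of_lt]

/-- Below `n` the tail sums drop by 0 or 1 at each step, and the minimum of two such sequences does
the same. -/
theorem Admissible.meetExp (hε : Admissible ε) (hδ : Admissible δ) :
    Admissible (meetExp ε δ) := by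
  constructor
  · intro i hi
    have := tail_le_of_admissible hε hi
    have := tail_le_of_admissible hδ hi
    unfold CTilde.meetExp
    omega
  · rw [← tail_last (CTilde.meetExp ε δ), tail_meetExp ε δ le_rfl, tail_last, tail_last]
    exact (min_le_left _ _).trans_lt hε.2

theorem Admissible.joinExp (hε : Admissible ε) (hδ : Admissible δ) :
    Admissible (joinExp ε δ) := by
  constructor
  · intro i hi
    have := tail_le_of_admissible hε hi
    have := tail_le_of_admissible hδ hi
    unfold CTilde.joinExp
    omega
  · rw [← tail_last (CTilde.joinExp ε δ), tail_joinExp ε δ le_rfl, tail_last, tail_last]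
    exact max_lt hε.2 hδ.2

/-- An inversion of any lower bound `u` in the group lies in both diagrams; by `refl_injective` it
is the same box in each, so it lies in their intersection. -/
theorem isGLB_word_meetExp (hn : 2 ≤ n) (hε : Admissible ε) (hδ : Admissible δ) :
    IsGLB {word ε, word δ} (word (meetExp ε δ)) := by
  have hα := hε.meetExp hδ
  constructor
  · rintro w (rfl | rfl)
    · rw [word_le_word_iff hn hα hε]
      exact fun k hk => (tail_meetExp ε δ hk).trans_le (min_le_left _ _)
    · rw [word_le_word_iff hn hα hδ]
      exact fun k hk => (tail_meetExp ε δ hk).trans_le (min_le_right _ _)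
  · intro u hu
    have h1 := (le_iff_isRightInversion _ _).mp (hu (Set.mem_insert _ _))
    have h2 := (le_iff_isRightInversion _ _).mp (hu (Set.mem_insert_of_mem _ rfl))
    rw [le_iff_isRightInversion]
    intro t ht
    obtain ⟨i, hi, j, hj, rfl⟩ := (isRightInversion_word_iff hn hε t).mp (h1 t ht)
    obtain ⟨i', hi', j', hj', he⟩ := (isRightInversion_word_iff hn hδ _).mp (h2 _ ht)
    obtain ⟨rfl, rfl⟩ := refl_injective hn hi hi' he
    refine (isRightInversion_word_iff hn hα _).mpr ⟨i, hi, j, ?_, rfl⟩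
    rw [tail_meetExp ε δ hi]
    exact lt_min hj hj'

/-- The union of the two diagrams is already the diagram of `joinExp`, so every upper bound in the
group contains it. -/
theorem isLUB_word_joinExp (hn : 2 ≤ n) (hε : Admissible ε) (hδ : Admissible δ) :
    IsLUB {word ε, word δ} (word (joinExp ε δ)) := by
  have hβ := hε.joinExp hδ
  constructor
  · rintro w (rfl | rfl)
    · rw [word_le_word_iff hn hε hβ]
      exact fun k hk => (le_max_left _ _).trans_eq (tail_joinExp ε δ hk).symm
    · rw [word_le_word_iff hn hδ hβ]
      exact fun k hk => (le_max_right _ _).trans_eq (tail_joinExp ε δ hk).symm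
  · intro u hu
    have h1 := (le_iff_isRightInversion _ _).mp (hu (Set.mem_insert _ _))
    have h2 := (le_iff_isRightInversion _ _).mp (hu (Set.mem_insert_of_mem _ rfl))
    rw [le_iff_isRightInversion]
    intro t ht
    obtain ⟨i, hi, j, hj, rfl⟩ := (isRightInversion_word_iff hn hβ t).mp ht
    rw [tail_joinExp ε δ hi, lt_max_iff] at hj
    rcases hj with hj | hj
    · exact h1 _ ((isRightInversion_word_iff hn hε _).mpr ⟨i, hi, j, hj, rfl⟩)
    · exact h2 _ ((isRightInversion_word_iff hn hδ _).mpr ⟨i, hi, j, hj, rfl⟩)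

theorem len_word_joinExp_add_len_word_meetExp (hn : 2 ≤ n) (hε : Admissible ε)
    (hδ : Admissible δ) :
    len (word (joinExp ε δ)) + len (word (meetExp ε δ)) = len (word ε) + len (word δ) := by
  rw [len_word hn hε, len_word hn hδ, len_word hn (hε.meetExp hδ), len_word hn (hε.joinExp hδ),
    ← Finset.sum_add_distrib, ← Finset.sum_add_distrib]
  refine Finset.sum_congr rfl fun i hi => ?_
  have hi' : i ≤ n := Nat.lt_succ_iff.mp (Finset.mem_range.mp hi)
  rw [tail_joinExp ε δ hi', tail_meetExp ε δ hi', max_add_min]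

end MeetJoin

/-! ### The modular lattice `Rₙ` -/

/-- The exponent vector of an element of `Rₙ`. -/
noncomputable def exponents (r : R n) : Fin (n + 1) → ℕ := r.2.choose

theorem admissible_exponents (r : R n) : Admissible (exponents r) := r.2.choose_spec.1

theorem word_exponents (r : R n) : word (exponents r) = r := r.2.choose_spec.2.symm

/-- The chosen exponents are the given ones: equal words dominate each other, so their tail sums
agree. -/
theorem exponents_word (hn : 2 ≤ n) {ε : Fin (n + 1) → ℕ} (hε : Admissible ε) :
    exponents ⟨word ε, ε, hε, rfl⟩ = ε := by
  have h := word_exponents ⟨word ε, ε, hε, rfl⟩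
  have ha := admissible_exponents ⟨word ε, ε, hε, rfl⟩
  exact eq_of_tail_eq fun k hk => le_antisymm
    ((word_le_word_iff hn ha hε).mp h.le k hk) ((word_le_word_iff hn hε ha).mp h.ge k hk)

/-- The join of two elements of `Rₙ`. -/
noncomputable def join (r t : R n) : R n :=
  ⟨word (joinExp (exponents r) (exponents t)), _,
    (admissible_exponents r).joinExp (admissible_exponents t), rfl⟩

/-- The meet of two elements of `Rₙ`. -/
noncomputable def meet (r t : R n) : R n :=
  ⟨word (meetExp (exponents r) (exponents t)), _,
    (admissible_exponents r).meetExp (admissible_exponents t), rfl⟩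

theorem isLUB_join (hn : 2 ≤ n) (r t : R n) : IsLUB {(r : W n), (t : W n)} (join r t : W n) := by
  have := isLUB_word_joinExp hn (admissible_exponents r) (admissible_exponents t)
  rwa [word_exponents, word_exponents] at this

theorem isGLB_meet (hn : 2 ≤ n) (r t : R n) : IsGLB {(r : W n), (t : W n)} (meet r t : W n) := by
  have := isGLB_word_meetExp hn (admissible_exponents r) (admissible_exponents t)
  rwa [word_exponents, word_exponents] at this

/-- The lattice structure on `Rₙ` given by the left weak order. -/
noncomputable abbrev latticeR (hn : 2 ≤ n) : Lattice (R n) where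
  __ := (inferInstance : PartialOrder (R n))
  sup := join
  inf := meet
  le_sup_left r t := (isLUB_join hn r t).1 (Set.mem_insert _ _)
  le_sup_right r t := (isLUB_join hn r t).1 (Set.mem_insert_of_mem _ rfl)
  sup_le r t u h h' := (isLUB_join hn r t).2 (by rintro w (rfl | rfl) <;> assumption)
  inf_le_left r t := (isGLB_meet hn r t).1 (Set.mem_insert _ _)
  inf_le_right r t := (isGLB_meet hn r t).1 (Set.mem_insert_of_mem _ rfl)
  le_inf u r t h h' := (isGLB_meet hn r t).2 (by rintro w (rfl | rfl) <;> assumption)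

theorem le_iff_tail_exponents (hn : 2 ≤ n) (r t : R n) :
    r ≤ t ↔ ∀ k ≤ n, tail (exponents r) k ≤ tail (exponents t) k := by
  rw [← word_le_word_iff hn (admissible_exponents r) (admissible_exponents t), word_exponents,
    word_exponents]
  rfl

theorem tail_exponents_join (hn : 2 ≤ n) (r t : R n) {k : ℕ} (hk : k ≤ n) :
    tail (exponents (join r t)) k = max (tail (exponents r) k) (tail (exponents t) k) := by
  rw [join, exponents_word hn ((admissible_exponents r).joinExp (admissible_exponents t)),
    tail_joinExp _ _ hk]

theorem tail_exponents_meet (hn : 2 ≤ n) (r t : R n) {k : ℕ} (hk : k ≤ n) :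
    tail (exponents (meet r t)) k = min (tail (exponents r) k) (tail (exponents t) k) := by
  rw [meet, exponents_word hn ((admissible_exponents r).meetExp (admissible_exponents t)),
    tail_meetExp _ _ hk]

/-- Tail sums embed `Rₙ` in a product of chains, with join and meet becoming `max` and `min`; the
modular law is checked coordinatewise. -/
theorem isModularLattice_latticeR (hn : 2 ≤ n) :
    @IsModularLattice (R n) (latticeR hn) := by
  let _ := latticeR hn
  constructor
  intro x y z hxz
  have h := (le_iff_tail_exponents hn x z).mp hxz
  refine (le_iff_tail_exponents hn (meet (join x y) z) (join x (meet y z))).mpr fun k hk => ?_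
  rw [tail_exponents_meet hn _ _ hk, tail_exponents_join hn _ _ hk, tail_exponents_join hn _ _ hk,
    tail_exponents_meet hn _ _ hk]
  have := h k hk
  omega

theorem len_join_add_len_meet (hn : 2 ≤ n) (r t : R n) :
    len (join r t : W n) + len (meet r t : W n) = len (r : W n) + len (t : W n) := by
  have := len_word_joinExp_add_len_word_meetExp hn (admissible_exponents r)
    (admissible_exponents t)
  rwa [word_exponents, word_exponents] at this

end CTilde

theorem corollary3p15 (n : ℕ) (hn : 2 ≤ n) :
    -- the weak order on `Rₙ` is the dominance order on exponent vectors
    (∀ ε δ : Fin (n + 1) → ℕ, CTilde.Admissible ε → CTilde.Admissible δ →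
      (CTilde.word ε ≤ CTilde.word δ ↔
        ∀ k : Fin (n + 1), CTilde.tail ε k ≤ CTilde.tail δ k) ∧
      (CTilde.word ε < CTilde.word δ ↔
        (∀ k : Fin (n + 1), CTilde.tail ε k ≤ CTilde.tail δ k) ∧ ε ≠ δ)) ∧
    -- meets and joins, taken in the weak order on the whole group
    (∀ ε δ : Fin (n + 1) → ℕ, CTilde.Admissible ε → CTilde.Admissible δ →
      (CTilde.Admissible (CTilde.meetExp ε δ) ∧
        (∀ k : Fin (n + 1), CTilde.tail (CTilde.meetExp ε δ) k =
          min (CTilde.tail ε k) (CTilde.tail δ k)) ∧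
        IsGLB {CTilde.word ε, CTilde.word δ} (CTilde.word (CTilde.meetExp ε δ))) ∧
      (CTilde.Admissible (CTilde.joinExp ε δ) ∧
        (∀ k : Fin (n + 1), CTilde.tail (CTilde.joinExp ε δ) k =
          max (CTilde.tail ε k) (CTilde.tail δ k)) ∧
        IsLUB {CTilde.word ε, CTilde.word δ} (CTilde.word (CTilde.joinExp ε δ)))) ∧
    -- `Rₙ` is a modular lattice under the weak order, and the length is a valuation
    (∃ L : Lattice (CTilde.R n),
      (∀ r t : CTilde.R n, L.le r t ↔ (r : CTilde.W n) ≤ (t : CTilde.W n)) ∧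
      @IsModularLattice (CTilde.R n) L ∧
      ∀ r t : CTilde.R n,
        IsLUB {(r : CTilde.W n), (t : CTilde.W n)} (L.sup r t : CTilde.W n) ∧
        IsGLB {(r : CTilde.W n), (t : CTilde.W n)} (L.inf r t : CTilde.W n) ∧
        CTilde.len (L.sup r t : CTilde.W n) + CTilde.len (L.inf r t : CTilde.W n) =
          CTilde.len (r : CTilde.W n) + CTilde.len (t : CTilde.W n)) := by
  have dom : ∀ ε δ : Fin (n + 1) → ℕ, CTilde.Admissible ε → CTilde.Admissible δ →
      (CTilde.word ε ≤ CTilde.word δ ↔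
        ∀ k : Fin (n + 1), CTilde.tail ε k ≤ CTilde.tail δ k) := by
    intro ε δ hε hδ
    rw [CTilde.word_le_word_iff hn hε hδ]
    exact ⟨fun h k => h k (Nat.lt_succ_iff.mp k.2), fun h k hk => h ⟨k, Nat.lt_succ_of_le hk⟩⟩
  refine ⟨fun ε δ hε hδ => ⟨dom ε δ hε hδ, ?_⟩, fun ε δ hε hδ => ?_, CTilde.latticeR hn,
    fun r t => Iff.rfl, CTilde.isModularLattice_latticeR hn, fun r t =>
      ⟨CTilde.isLUB_join hn r t, CTilde.isGLB_meet hn r t, CTilde.len_join_add_len_meet hn r t⟩⟩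
  · rw [lt_iff_le_and_ne, dom ε δ hε hδ]
    refine and_congr_right fun _ => not_congr ⟨fun h => ?_, fun h => h ▸ rfl⟩
    exact CTilde.eq_of_tail_eq fun k hk => le_antisymm
      ((CTilde.word_le_word_iff hn hε hδ).mp h.le k hk)
      ((CTilde.word_le_word_iff hn hδ hε).mp h.ge k hk)
  · exact ⟨⟨hε.meetExp hδ, fun k => CTilde.tail_meetExp ε δ (Nat.lt_succ_iff.mp k.2),
        CTilde.isGLB_word_meetExp hn hε hδ⟩,
      hε.joinExp hδ, fun k => CTilde.tail_joinExp ε δ (Nat.lt_succ_iff.mp k.2),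
        CTilde.isLUB_word_joinExp hn hε hδ⟩
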